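/- Let $n>2r\ge 0$ be integers and let $KG(n,r)$ be the Kneser graph: its vertices are the $r$-element subsets of $\{1,\dots,n\}$, and two distinct vertices are adjacent if and only if the corresponding sets are disjoint. Let $q$ be an element of a field $K$ of characteristic zero (for example a real number, or an indeterminate $q\in K=\mathbb{Q}(q)$), and let $\mathcal{D}_q$ be the exponential distance matrix of $KG(n,r)$, whose $(u,v)$-entry is $q^{\operatorname{dist}(u,v)}$ if $u$ and $v$ lie in the same component and $0$ otherwise (with $q^0=1$). Then the spectrum of $\mathcal{D}_q$ consists of the eigenvalues \[ \lambda_j=\sum_{i=0}^{r} q^{f(i)}\,p_i(j)\quad\text{with multiplicity}\quad m_j=\frac{n-2j+1}{n-j+1}\binom{n}{j},\qquad j=0,1,\dots,r, \] where \[ p_i(j)=\sum_{t=0}^{j}(-1)^t\binom{j}{t}\binom{r-j}{i-t}\binom{n-r-j}{i-t},\qquad f(i)=\min\Big\{2\Big\lceil\frac{i}{n-2r}\Big\rceil,\;2\Big\lceil\frac{r-i}{n-2r}\Big\rceil+1\Big\}, \] and binomial coefficients with a negative lower entry are $0$. That is, each $m_j$ is a non-negative integer, the characteristic polynomial of $\mathcal{D}_q$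 is $\prod_{j=0}^{r}(x-\lambda_j)^{m_j}$, and for every $\mu\in K$ the eigenspace of $\mathcal{D}_q$ for $\mu$ has dimension $\sum_{j:\,\lambda_j=\mu}m_j$ (so that multiplicities add up when some of the $\lambda_j$ coincide). -/

import Mathlib

/-- The Kneser graph `KG(n, r)`: vertices are the `r`-element subsets of an `n`-element set, and two
(distinct) vertices are adjacent iff the corresponding sets are disjoint.  Distinctness is automatic
unless `r = 0`, where it only excludes a loop at the empty set. -/
def kneserGraph (n r : ℕ) : SimpleGraph {s : Finset (Fin n) // s.card = r} where
  Adj s t := s ≠ t ∧ Disjoint s.1 t.1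
  symm := ⟨fun _ _ h => ⟨h.1.symm, h.2.symm⟩⟩
  loopless := ⟨fun _ h => h.1 rfl⟩

open Classical in
/-- The exponential distance matrix of a graph: the `(u, v)`-entry is `q ^ dist(u, v)` if `u` and `v`
lie in the same component, and `0` otherwise. -/
noncomputable def SimpleGraph.expDistMatrix {V K : Type*} [Semiring K] (G : SimpleGraph V) (q : K) :
    Matrix V V K :=
  Matrix.of fun u v => if G.Reachable u v then q ^ G.dist u v else 0

/-- `p_i(j) = ∑_{t=0}^{j} (-1)^t C(j,t) C(r-j,i-t) C(n-r-j,i-t)`.  Binomial coefficients with a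
negative lower entry vanish, so only the terms with `t ≤ i` contribute. Used for `j ≤ r ≤ n - r`. -/
def kneserP (n r i j : ℕ) : ℤ :=
  ∑ t ∈ Finset.range (j + 1), if t ≤ i then
    (-1 : ℤ) ^ t * (j.choose t : ℤ) * ((r - j).choose (i - t) : ℤ) * ((n - r - j).choose (i - t) : ℤ)
  else 0

/-- `f(i) = min {2 ⌈i / (n - 2r)⌉, 2 ⌈(r - i) / (n - 2r)⌉ + 1}`. Used for `i ≤ r` and `2r < n`. -/
def kneserF (n r i : ℕ) : ℕ :=
  min (2 * ⌈(i : ℚ) / ((n : ℚ) - 2 * (r : ℚ))⌉₊)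
    (2 * ⌈((r : ℚ) - (i : ℚ)) / ((n : ℚ) - 2 * (r : ℚ))⌉₊ + 1)

/-- `λ_j = ∑_{i=0}^{r} q^{f(i)} p_i(j)`. -/
def kneserEigenvalue {K : Type*} [Ring K] (q : K) (n r j : ℕ) : K :=
  ∑ i ∈ Finset.range (r + 1), q ^ kneserF n r i * (kneserP n r i j : K)

/-!
The `(A, B)`-entry of the exponential distance matrix depends only on `|B \ A|`, so the matrix lies in
the Bose–Mesner algebra of the Johnson scheme, which is diagonalized by harmonic functions.

*Distance.* Two disjoint steps from `A` to `C` exchange at most `n - 2r` elements, and every such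
exchange is possible. Hence a walk of length `2k` from `A` to `B` forces `|B \ A| ≤ k (n - 2r)`, a walk
of length `2k + 1` forces `|B ∩ A| ≤ k (n - 2r)` (`card_le_of_walk`), and for `r > 0` these conditions
yield walks of at most these lengths (`exists_walk_even`, `exists_walk_odd`). This gives `dist(A, B) = f(|B \ A|)`
(`kneserGraph_reachable_and_dist`).

*Eigenvectors.* Call a function `g` on `j`-sets harmonic if, for every `(j - 1)`-set `S`, its values at
the `j`-sets containing `S` sum to zero. For such a `g` and any set `A`, the sum of `g` over the `j`-sets
with `t` points outside `A` is `(-1)^t C(j, t)` times the sum over the `j`-subsets of `A`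
(`harmonic_layer`). So the lift `A ↦ ∑_{T ⊆ A} g(T)` to `r`-sets is an eigenvector of every matrix with
entries `[|B \ A| = i]`. Counting gives the eigenvalue as
`∑_t (-1)^t C(j, t) C(r - j + t, i) C(n - r - t, i - t)`, and a comparison of coefficients in
`((1 + y) - y (1 + x))^j = (1 - x y)^j` turns it into `p_i(j)` (`sum_choose_eq_sum_choose`,
`sum_sliceUp_of_mem_harmonic`). The same computation shows that lifting is injective on harmonic
functions (`sliceUp_injOn_harmonic`).

*Completeness.* The lifts for different `j` are independent because the values `p_1(j)` are distinct.
Their dimensions are at least `C(n, j) - C(n, j - 1)`, which add up to `C(n, r)`, so they decompose the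
whole space with exactly these dimensions (`isInternal_harmonicLift`), and the matrix is diagonal in an
adapted basis.
-/

namespace KneserSpectrum

/-! ### Distances in the Kneser graph -/

section Distance

variable {n r : ℕ}

/-- Along a walk of even length `2k` the start loses at most `k (n - 2r)` elements; along a walk of
odd length `2k + 1` the two ends share at most `k (n - 2r)` elements. -/
theorem card_le_of_walk {A B : {s : Finset (Fin n) // s.card = r}} (w : (kneserGraph n r).Walk A B) :
    (∀ k, w.length = 2 * k → (B.1 \ A.1).card ≤ k * (n - 2 * r)) ∧
      (∀ k, w.length = 2 * k + 1 → (B.1 ∩ A.1).card ≤ k * (n - 2 * r)) := by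
  induction w with
  | nil =>
    refine ⟨fun k _ => by simp, fun k hk => by simp at hk⟩
  | @cons A C B h w ih =>
    have hd : Disjoint A.1 C.1 := h.2
    refine ⟨fun k hk => ?_, fun k hk => ?_⟩
    · obtain ⟨k, rfl⟩ : ∃ k', k = k' + 1 := ⟨k - 1, by simp at hk; omega⟩
      have h1 := ih.2 k (by simp at hk; omega)
      have hsub : B.1 \ A.1 ⊆ (B.1 ∩ C.1) ∪ (A.1 ∪ C.1)ᶜ := by
        intro x hx
        simp only [Finset.mem_sdiff, Finset.mem_union, Finset.mem_inter, Finset.mem_compl] at hx ⊢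
        tauto
      have hc : ((A.1 ∪ C.1)ᶜ).card = n - 2 * r := by
        rw [Finset.card_compl, Finset.card_union_of_disjoint hd, A.2, C.2, Fintype.card_fin]
        omega
      calc _ ≤ _ := Finset.card_le_card hsub
        _ ≤ _ := Finset.card_union_le _ _
        _ ≤ k * (n - 2 * r) + (n - 2 * r) := by omega
        _ = _ := by ring
    · have h1 := ih.1 k (by simp at hk; omega)
      refine (Finset.card_le_card ?_).trans h1
      intro x hx
      simp only [Finset.mem_sdiff, Finset.mem_inter] at hx ⊢
      exact ⟨hx.1, Finset.disjoint_left.1 hd hx.2⟩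

theorem card_sdiff_symm {α : Type*} [DecidableEq α] {A B : Finset α} (h : A.card = B.card) :
    (A \ B).card = (B \ A).card := by
  have := Finset.card_sdiff_add_card_inter A B
  have := Finset.card_sdiff_add_card_inter B A
  rw [Finset.inter_comm] at this
  omega

theorem adj_of_disjoint (hr : 0 < r) {A B : {s : Finset (Fin n) // s.card = r}}
    (h : Disjoint A.1 B.1) : (kneserGraph n r).Adj A B := by
  refine ⟨?_, h⟩
  rintro rfl
  have := A.2
  rw [disjoint_self.1 h] at this
  simp at this
  omega

/-- The restriction `0 < r` keeps the two steps of an exchange proper edges: for `r = 0` the graph has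
no edges. -/
theorem exists_walk_even (hnr : 2 * r < n) (hr : 0 < r) (k : ℕ) :
    ∀ A B : {s : Finset (Fin n) // s.card = r}, (B.1 \ A.1).card ≤ k * (n - 2 * r) →
      ∃ w : (kneserGraph n r).Walk A B, w.length ≤ 2 * k := by
  induction k with
  | zero =>
    intro A B h
    have h1 : B.1 ⊆ A.1 := by
      simpa [Finset.sdiff_eq_empty_iff_subset] using h
    obtain rfl : B = A := Subtype.ext (Finset.eq_of_subset_of_card_le h1 (by rw [A.2, B.2]))
    exact ⟨.nil, by simp⟩
  | succ k ih =>
    intro A B h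
    have hAB : (A.1 \ B.1).card = (B.1 \ A.1).card := card_sdiff_symm (by rw [A.2, B.2])
    -- replace up to `n - 2r` elements of `A` by elements of `B`
    obtain ⟨X, hX, hXc⟩ := Finset.exists_subset_card_eq
      (min_le_right (n - 2 * r) (B.1 \ A.1).card)
    obtain ⟨Y, hY, hYc⟩ := Finset.exists_subset_card_eq
      ((min_le_right (n - 2 * r) (B.1 \ A.1).card).trans hAB.ge)
    have hdX : Disjoint (A.1 \ Y) X := by
      rw [Finset.disjoint_left]
      intro x hx hx'
      have := hX hx'
      simp only [Finset.mem_sdiff] at this hx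
      tauto
    have hYA : Y ⊆ A.1 := hY.trans Finset.sdiff_subset
    have hYr : Y.card ≤ r := by rw [← A.2]; exact Finset.card_le_card hYA
    let M : {s : Finset (Fin n) // s.card = r} := ⟨(A.1 \ Y) ∪ X, by
      rw [Finset.card_union_of_disjoint hdX, Finset.card_sdiff_of_subset hYA, A.2]
      omega⟩
    obtain ⟨w, hw⟩ := ih M B (by
      have : B.1 \ M.1 ⊆ (B.1 \ A.1) \ X := by
        intro x hx
        have := @hY x
        simp only [M, Finset.mem_sdiff, Finset.mem_union] at hx this ⊢
        tauto
      refine (Finset.card_le_card this).trans ?_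
      rw [Finset.card_sdiff_of_subset hX, hXc]
      rw [add_mul, one_mul] at h
      omega)
    obtain ⟨C, hC, hCc⟩ := Finset.exists_subset_card_eq (s := (A.1 ∪ X)ᶜ) (n := r) (by
      have := Finset.card_union_le A.1 X
      have := A.2
      rw [Finset.card_compl, Fintype.card_fin]
      omega)
    have hCA : Disjoint A.1 C := by
      rw [Finset.disjoint_left]
      intro x hx hx'
      have := hC hx'
      simp only [Finset.mem_compl, Finset.mem_union] at this
      tauto
    have hCM : Disjoint C M.1 := by
      rw [Finset.disjoint_left]
      intro x hx hx'
      have := hC hx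
      simp only [M, Finset.mem_compl, Finset.mem_union, Finset.mem_sdiff] at this hx'
      tauto
    exact ⟨.cons (adj_of_disjoint (B := ⟨C, hCc⟩) hr hCA) (.cons (adj_of_disjoint hr hCM) w), by
      simp only [SimpleGraph.Walk.length_cons]; omega⟩

theorem exists_walk_odd (hnr : 2 * r < n) (hr : 0 < r) (k : ℕ)
    (A B : {s : Finset (Fin n) // s.card = r}) (h : (B.1 ∩ A.1).card ≤ k * (n - 2 * r)) :
      ∃ w : (kneserGraph n r).Walk A B, w.length ≤ 2 * k + 1 := by
  -- leave `A` through a set which contains as much of `B` as possible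
  obtain ⟨C, hC1, hC2, hCc⟩ := Finset.exists_subsuperset_card_eq (s := B.1 \ A.1) (t := A.1ᶜ)
    (n := r) (fun x hx => by simp at hx ⊢; exact hx.2)
    (by conv_rhs => rw [← B.2]
        exact Finset.card_le_card Finset.sdiff_subset)
    (by rw [Finset.card_compl, Fintype.card_fin, A.2]; omega)
  obtain ⟨w, hw⟩ := exists_walk_even hnr hr k ⟨C, hCc⟩ B (by
    refine (Finset.card_le_card ?_).trans h
    intro x hx
    have := @hC1 x
    simp only [Finset.mem_sdiff, Finset.mem_inter] at hx this ⊢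
    tauto)
  have hd : Disjoint A.1 C := by
    rw [Finset.disjoint_left]
    intro x hx hx'
    have := hC2 hx'
    simp at this
    tauto
  exact ⟨.cons (adj_of_disjoint (B := ⟨C, hCc⟩) hr hd) w, by
    simp only [SimpleGraph.Walk.length_cons]; omega⟩

theorem ceil_div_le_iff (hnr : 2 * r < n) (x : ℚ) (k : ℕ) :
    ⌈x / ((n : ℚ) - 2 * (r : ℚ))⌉₊ ≤ k ↔ x ≤ ((k * (n - 2 * r) : ℕ) : ℚ) := by
  have h : (n : ℚ) - 2 * r = ((n - 2 * r : ℕ) : ℚ) := by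
    rw [Nat.cast_sub hnr.le]; push_cast; ring
  have h0 : (0 : ℚ) < ((n - 2 * r : ℕ) : ℚ) := by
    rw [Nat.cast_pos]; omega
  rw [h, Nat.ceil_le, div_le_iff₀ h0, Nat.cast_mul]

/-- The distance formula of the Kneser graph. -/
theorem kneserGraph_reachable_and_dist (hnr : 2 * r < n)
    (A B : {s : Finset (Fin n) // s.card = r}) :
    (kneserGraph n r).Reachable A B ∧
      (kneserGraph n r).dist A B = kneserF n r (B.1 \ A.1).card := by
  rcases Nat.eq_zero_or_pos r with rfl | hr
  · obtain rfl : A = B := Subtype.ext (by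
      rw [Finset.card_eq_zero.1 A.2, Finset.card_eq_zero.1 B.2])
    exact ⟨.refl _, by simp [kneserF]⟩
  have hcard := Finset.card_sdiff_add_card_inter B.1 A.1
  rw [B.2] at hcard
  have hcast : (r : ℚ) - ((B.1 \ A.1).card : ℚ) = (((B.1 ∩ A.1).card : ℕ) : ℚ) := by
    rw [sub_eq_iff_eq_add, add_comm]; exact_mod_cast hcard.symm
  have heven : ∀ k, ⌈((B.1 \ A.1).card : ℚ) / ((n : ℚ) - 2 * (r : ℚ))⌉₊ ≤ k ↔
      (B.1 \ A.1).card ≤ k * (n - 2 * r) := fun k => by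
    rw [ceil_div_le_iff hnr, Nat.cast_le]
  have hodd : ∀ k, ⌈((r : ℚ) - ((B.1 \ A.1).card : ℚ)) / ((n : ℚ) - 2 * (r : ℚ))⌉₊ ≤ k ↔
      (B.1 ∩ A.1).card ≤ k * (n - 2 * r) := fun k => by
    rw [ceil_div_le_iff hnr, hcast, Nat.cast_le]
  obtain ⟨w₀, hw₀⟩ := exists_walk_even hnr hr _ A B ((heven _).1 le_rfl)
  obtain ⟨w₁, hw₁⟩ := exists_walk_odd hnr hr _ A B ((hodd _).1 le_rfl)
  have hreach : (kneserGraph n r).Reachable A B := ⟨w₀⟩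
  refine ⟨hreach, le_antisymm ?_ ?_⟩
  · exact le_min ((SimpleGraph.dist_le w₀).trans hw₀) ((SimpleGraph.dist_le w₁).trans hw₁)
  · obtain ⟨w, hw⟩ := hreach.exists_walk_length_eq_dist
    obtain ⟨h0, h1⟩ := card_le_of_walk w
    rw [← hw]
    rcases Nat.even_or_odd' w.length with ⟨k, hk | hk⟩
    · have := (heven k).2 (h0 k hk)
      exact (min_le_left _ _).trans (by omega)
    · have := (hodd k).2 (h1 k hk)
      exact (min_le_right _ _).trans (by omega)

end Distance

/-! ### An identity of binomial sums -/

/-- Two expansions of `(1 + x) ^ a * (1 + y) ^ b * (1 - x * y) ^ j`, the first of which uses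
`1 - x * y = (1 + y) - y * (1 + x)`. -/
theorem sum_pow_eq_sum_pow {R : Type*} [CommRing R] (x y : R) (j a b : ℕ) :
    ∑ t ∈ Finset.range (j + 1), y ^ t * ((1 + y) ^ (b + (j - t)) *
        ((-1) ^ t * (j.choose t : R) * (1 + x) ^ (a + t))) =
      ∑ t ∈ Finset.range (j + 1), y ^ t * ((1 + y) ^ b *
        ((-1) ^ t * (j.choose t : R) * (x ^ t * (1 + x) ^ a))) := by
  have h : (-(y * (1 + x)) + (1 + y)) ^ j = (-(y * x) + 1) ^ j := by
    congr 1; ring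
  rw [add_pow, add_pow] at h
  have h' := congrArg (fun p => p * ((1 + y) ^ b * (1 + x) ^ a)) h
  simp only [Finset.sum_mul] at h'
  refine (Finset.sum_congr rfl fun t _ => ?_).trans (h'.trans (Finset.sum_congr rfl fun t _ => ?_))
  · rw [neg_pow (y * (1 + x)), mul_pow, pow_add, pow_add]
    ring
  · rw [neg_pow (y * x), mul_pow, one_pow]
    ring

open Polynomial in
/-- The coefficient of `x ^ i * y ^ k` in `sum_pow_eq_sum_pow`. -/
theorem sum_choose_eq_sum_choose (j a b i k : ℕ) :
    ∑ t ∈ Finset.range (j + 1), (-1 : ℤ) ^ t * (j.choose t : ℤ) *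
      (((a + t).choose i : ℤ) * if t ≤ k then ((b + (j - t)).choose (k - t) : ℤ) else 0) =
    ∑ t ∈ Finset.range (j + 1), (-1 : ℤ) ^ t * (j.choose t : ℤ) *
      ((if t ≤ i then (a.choose (i - t) : ℤ) else 0) *
        if t ≤ k then (b.choose (k - t) : ℤ) else 0) := by
  have key := sum_pow_eq_sum_pow (C (X : ℤ[X])) (X : ℤ[X][X]) j a b
  have e1 : ∀ t : ℕ, ((-1) ^ t * (j.choose t : ℤ[X][X])) = C (C ((-1) ^ t * (j.choose t : ℤ))) :=
    fun t => by simp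
  have e2 : (1 : ℤ[X][X]) + C X = C (1 + X) := by simp
  simp only [e1, e2, ← C_pow, ← C_mul] at key
  have hco := congrArg (fun p : ℤ[X][X] => (p.coeff k).coeff i) key
  simp only [finsetSum_coeff, coeff_X_pow_mul', coeff_mul_C, coeff_one_add_X_pow] at hco
  refine (Finset.sum_congr rfl fun t _ => ?_).trans (hco.trans (Finset.sum_congr rfl fun t _ => ?_))
  · split_ifs
    · rw [mul_comm ((_ : ℕ) : ℤ[X]), coeff_mul_natCast, coeff_C_mul, coeff_one_add_X_pow]
      ring
    · simp
  · split_ifs with h1 h2 h2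
    · rw [mul_comm ((_ : ℕ) : ℤ[X]), coeff_mul_natCast, coeff_C_mul, coeff_X_pow_mul',
        if_pos h2, coeff_one_add_X_pow]
      ring
    · rw [mul_comm ((_ : ℕ) : ℤ[X]), coeff_mul_natCast, coeff_C_mul, coeff_X_pow_mul',
        if_neg h2, zero_mul, mul_zero, zero_mul]
    · simp
    · simp

/-! ### Counting sets and harmonic functions -/

section Slices

variable {α : Type*} [Fintype α] [DecidableEq α]

/-- The set obtained from `A` by removing `X` and adding `T \ A` and `Y` contains `T`, and `X` and `Y`
can be recovered from it. -/
theorem exchange_identities {A T X Y : Finset α} (hX : X ⊆ A \ T) (hY : Y ⊆ (A ∪ T)ᶜ) :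
    ((A \ X ∪ (T \ A)) ∪ Y) \ A = (T \ A) ∪ Y ∧ A \ ((A \ X ∪ (T \ A)) ∪ Y) = X ∧
      ((T \ A) ∪ Y) \ T = Y ∧ Disjoint (T \ A) Y ∧ T ⊆ (A \ X ∪ (T \ A)) ∪ Y := by
  have hX' : ∀ x, x ∈ X → x ∈ A ∧ x ∉ T := fun x hx => Finset.mem_sdiff.1 (hX hx)
  have hY' : ∀ x, x ∈ Y → x ∉ A ∧ x ∉ T := fun x hx => by simpa using hY hx
  clear hX hY
  refine ⟨?_, ?_, ?_, ?_, ?_⟩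
  · ext x; grind
  · ext x; grind
  · ext x; grind
  · rw [Finset.disjoint_left]; grind
  · intro x; grind

/-- The number of sets of size `r` which contain `T` and have `i` points outside `A`: such a set is
determined by the `i` points of `A \ T` which it misses and by its `i - |T \ A|` points outside
`A ∪ T`. -/
theorem card_filter_superset_sdiff {r j : ℕ} {A T : Finset α} (hA : A.card = r) (hT : T.card = j)
    (hjr : j ≤ r) (hn : j + r ≤ Fintype.card α) (i : ℕ) :
    (Finset.univ.filter fun B : {s : Finset α // s.card = r} =>
      T ⊆ B.1 ∧ (B.1 \ A).card = i).card =
    (r - j + (T \ A).card).choose i *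
      if (T \ A).card ≤ i then
        (Fintype.card α - r - j + (j - (T \ A).card)).choose (i - (T \ A).card) else 0 := by
  have hTc := Finset.card_sdiff_add_card_inter T A
  have hAc := Finset.card_sdiff_add_card_inter A T
  rw [Finset.inter_comm] at hAc
  split_ifs with hi
  · have h1 : (A \ T).card = r - j + (T \ A).card := by omega
    have h2 : ((A ∪ T)ᶜ).card = Fintype.card α - r - j + (j - (T \ A).card) := by
      have := Finset.card_union_add_card_inter A T
      rw [Finset.inter_comm] at this
      rw [Finset.card_compl]; omega
    rw [← h1, ← h2, ← Finset.card_powersetCard, ← Finset.card_powersetCard, ← Finset.card_product]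
    refine Finset.card_bij (fun B _ => (A \ B.1, (B.1 \ A) \ T)) ?_ ?_ ?_
    · intro B hB
      obtain ⟨hTB, hBi⟩ := (Finset.mem_filter.1 hB).2
      have hAB : (A \ B.1).card = i := (card_sdiff_symm (by rw [hA, B.2])).trans hBi
      have h3 : ((B.1 \ A) \ T).card = i - (T \ A).card := by
        rw [← hBi, ← Finset.card_sdiff_of_subset (Finset.sdiff_subset_sdiff hTB le_rfl)]
        congr 1
        ext x; simp only [Finset.mem_sdiff]; tauto
      rw [Finset.mem_product, Finset.mem_powersetCard, Finset.mem_powersetCard]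
      refine ⟨⟨Finset.sdiff_subset_sdiff le_rfl hTB, hAB⟩, fun x hx => ?_, h3⟩
      simp only [Finset.mem_sdiff, Finset.mem_compl, Finset.mem_union] at hx ⊢
      tauto
    · intro B hB C hC h
      have hTB := (Finset.mem_filter.1 hB).2.1
      have hTC := (Finset.mem_filter.1 hC).2.1
      obtain ⟨e1, e2⟩ := Prod.ext_iff.1 h
      ext x
      replace e1 : x ∈ A \ B.1 ↔ x ∈ A \ C.1 := Finset.ext_iff.1 e1 x
      replace e2 : x ∈ (B.1 \ A) \ T ↔ x ∈ (C.1 \ A) \ T := Finset.ext_iff.1 e2 x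
      have h3 := @hTB x
      have h4 := @hTC x
      clear hTB hTC h hB hC hTc hAc h1 h2
      simp only [Finset.mem_sdiff] at e1 e2
      tauto
    · rintro ⟨X, Y⟩ h
      rw [Finset.mem_product, Finset.mem_powersetCard, Finset.mem_powersetCard] at h
      obtain ⟨⟨hX, hXi⟩, hY, hYi⟩ := h
      obtain ⟨hB, hBA, hBT, hd, hTB⟩ := exchange_identities hX hY
      have hc : ((T \ A) ∪ Y).card = i := by
        rw [Finset.card_union_of_disjoint hd, hYi]
        omega
      refine ⟨⟨(A \ X ∪ (T \ A)) ∪ Y, ?_⟩, ?_, ?_⟩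
      · have e1 := Finset.card_sdiff_add_card_inter ((A \ X ∪ (T \ A)) ∪ Y) A
        have e2 := Finset.card_sdiff_add_card_inter A ((A \ X ∪ (T \ A)) ∪ Y)
        rw [hB, hc] at e1
        rw [hBA, hXi, Finset.inter_comm] at e2
        omega
      · simp only [Finset.mem_filter, Finset.mem_univ, true_and]
        exact ⟨hTB, by rw [hB, hc]⟩
      · exact Prod.ext hBA (by simp only [hB, hBT])
  · rw [mul_zero, Finset.card_eq_zero, Finset.filter_eq_empty_iff]
    rintro B - ⟨h1, h2⟩
    exact hi (h2 ▸ Finset.card_le_card (Finset.sdiff_subset_sdiff h1 le_rfl))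

theorem card_filter_superset (r : ℕ) (U : Finset α) :
    (Finset.univ.filter fun B : {s : Finset α // s.card = r} => U ⊆ B.1).card =
      if U.card ≤ r then (Fintype.card α - U.card).choose (r - U.card) else 0 := by
  split_ifs with h
  · rw [← Finset.card_compl, ← Finset.card_powersetCard]
    refine Finset.card_bij (fun B _ => B.1 \ U) ?_ ?_ ?_
    · intro B hB
      have hU := (Finset.mem_filter.1 hB).2
      rw [Finset.mem_powersetCard, Finset.card_sdiff_of_subset hU, B.2]
      exact ⟨fun x hx => by simp at hx ⊢; exact hx.2, rfl⟩
    · intro B hB C hC h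
      have hUB := (Finset.mem_filter.1 hB).2
      have hUC := (Finset.mem_filter.1 hC).2
      exact Subtype.ext (by rw [← Finset.sdiff_union_of_subset hUB, h,
        Finset.sdiff_union_of_subset hUC])
    · intro Y hY
      obtain ⟨hY, hc⟩ := Finset.mem_powersetCard.1 hY
      have hd : Disjoint Y U := by
        rw [Finset.disjoint_left]
        intro x hx hx'
        have := hY hx
        simp at this
        tauto
      refine ⟨⟨Y ∪ U, by rw [Finset.card_union_of_disjoint hd, hc]; omega⟩, ?_, ?_⟩
      · simp
      · simp only [Finset.union_sdiff_right, Finset.sdiff_eq_self_of_disjoint hd]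
  · rw [Finset.card_eq_zero, Finset.filter_eq_empty_iff]
    rintro B - h1
    exact h (B.2 ▸ Finset.card_le_card h1)

variable (α) (K : Type*) [Field K]

/-- The up operator from functions on `j`-sets to functions on `r`-sets: the value at `A` is the
sum of the values at the `j`-subsets of `A`. -/
def sliceUp (j r : ℕ) :
    ({s : Finset α // s.card = j} → K) →ₗ[K] ({s : Finset α // s.card = r} → K) where
  toFun g A := ∑ T, if T.1 ⊆ A.1 then g T else 0
  map_add' f g := by
    ext A; simp only [Pi.add_apply, ← Finset.sum_add_distrib]
    exact Finset.sum_congr rfl fun T _ => by split_ifs <;> simp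
  map_smul' c g := by
    ext A; simp [Finset.mul_sum]

/-- The down operator from functions on `j`-sets to functions on `(j - 1)`-sets: the value at `S`
is the sum of the values at the `j`-sets containing `S`. The target is indexed by the sets `S` with
`|S| + 1 = j`, so that it is zero for `j = 0`. -/
def sliceDown (j : ℕ) :
    ({s : Finset α // s.card = j} → K) →ₗ[K] ({s : Finset α // s.card + 1 = j} → K) where
  toFun g S := ∑ T, if S.1 ⊆ T.1 then g T else 0
  map_add' f g := by
    ext A; simp only [Pi.add_apply, ← Finset.sum_add_distrib]
    exact Finset.sum_congr rfl fun T _ => by split_ifs <;> simp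
  map_smul' c g := by
    ext A; simp [Finset.mul_sum]

/-- The harmonic functions on `j`-sets: the kernel of the down operator. -/
def harmonic (j : ℕ) : Submodule K ({s : Finset α // s.card = j} → K) :=
  LinearMap.ker (sliceDown α K j)

variable {α K}

/-- The subsets of `T` with one element fewer arise by erasing an element. -/
theorem sum_pred_card_eq_sum_erase {j : ℕ} {T : Finset α} (hT : T.card = j) (F : Finset α → K) :
    ∑ S : {s : Finset α // s.card + 1 = j}, (if S.1 ⊆ T then F S.1 else 0) =
      ∑ x ∈ T, F (T.erase x) := by
  rw [← Finset.sum_filter]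
  symm
  refine Finset.sum_bij (fun x hx => ⟨T.erase x, by rw [Finset.card_erase_add_one hx, hT]⟩)
    ?_ ?_ ?_ ?_
  · intro x hx
    simpa using Finset.erase_subset x T
  · intro x hx y hy h
    exact Finset.erase_injOn T hx hy (Subtype.ext_iff.1 h)
  · intro S hS
    have hS := (Finset.mem_filter.1 hS).2
    have hc : (T \ S.1).card = 1 := by
      have := S.2
      rw [Finset.card_sdiff_of_subset hS]; omega
    obtain ⟨x, hx⟩ := Finset.card_eq_one.1 hc
    have hxT : x ∈ T := (Finset.mem_sdiff.1 (hx ▸ Finset.mem_singleton_self x)).1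
    refine ⟨x, hxT, Subtype.ext ?_⟩
    change T.erase x = S.1
    rw [← Finset.sdiff_singleton_eq_erase, ← hx, Finset.sdiff_sdiff_eq_self hS]
  · intro x hx
    rfl

/-- Summing `sliceDown g = 0` over the sets with `t` points outside `A`. -/
theorem harmonic_recursion {j : ℕ} {g : {s : Finset α // s.card = j} → K}
    (hg : g ∈ harmonic α K j) (A : Finset α) (t : ℕ) :
    ((t : K) + 1) * (∑ T, if (T.1 \ A).card = t + 1 then g T else 0) +
      ((j : K) - t) * (∑ T, if (T.1 \ A).card = t then g T else 0) = 0 := by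
  have h0 : ∑ S : {s : Finset α // s.card + 1 = j}, (if (S.1 \ A).card = t then
      ∑ T : {s : Finset α // s.card = j}, (if S.1 ⊆ T.1 then g T else 0) else 0) = 0 := by
    refine Finset.sum_eq_zero fun S _ => ?_
    have : (∑ T : {s : Finset α // s.card = j}, if S.1 ⊆ T.1 then g T else 0) = 0 :=
      congrFun (LinearMap.mem_ker.1 hg) S
    rw [this, ite_self]
  refine Eq.trans ?_ h0
  rw [Finset.mul_sum, Finset.mul_sum, ← Finset.sum_add_distrib]
  have h1 : ∀ S : {s : Finset α // s.card + 1 = j}, (if (S.1 \ A).card = t then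
      ∑ T : {s : Finset α // s.card = j}, (if S.1 ⊆ T.1 then g T else 0) else 0) =
      ∑ T : {s : Finset α // s.card = j}, (if S.1 ⊆ T.1 then
        (if (S.1 \ A).card = t then g T else 0) else 0) := fun S => by
    split_ifs <;> simp
  simp only [h1]
  rw [Finset.sum_comm]
  refine Finset.sum_congr rfl fun T _ => ?_
  rw [sum_pred_card_eq_sum_erase T.2 (fun S => if (S \ A).card = t then g T else 0),
    ← Finset.sum_inter_add_sum_sdiff T.1 A]
  have hin : ∑ x ∈ T.1 ∩ A, (if (T.1.erase x \ A).card = t then g T else 0) =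
      ((T.1 ∩ A).card : K) * if (T.1 \ A).card = t then g T else 0 := by
    rw [← nsmul_eq_mul, ← Finset.sum_const]
    refine Finset.sum_congr rfl fun x hx => ?_
    rw [Finset.erase_sdiff_comm, Finset.erase_eq_of_notMem]
    simp at hx ⊢
    tauto
  have hout : ∑ x ∈ T.1 \ A, (if (T.1.erase x \ A).card = t then g T else 0) =
      ((T.1 \ A).card : K) * if (T.1 \ A).card = t + 1 then g T else 0 := by
    rw [← nsmul_eq_mul, ← Finset.sum_const]
    refine Finset.sum_congr rfl fun x hx => ?_
    rw [Finset.erase_sdiff_comm]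
    refine if_congr ?_ rfl rfl
    rw [← Finset.card_erase_add_one hx, Nat.add_right_cancel_iff]
  have hc : ((T.1 \ A).card : K) + ((T.1 ∩ A).card : K) = j := by
    rw [← Nat.cast_add, Finset.card_sdiff_add_card_inter, T.2]
  rw [hin, hout, add_comm]
  congr 1
  · by_cases h : (T.1 \ A).card = t
    · rw [if_pos h, ← hc, h]; ring
    · rw [if_neg h, mul_zero, mul_zero]
  · by_cases h : (T.1 \ A).card = t + 1
    · rw [if_pos h, h]; push_cast; ring
    · rw [if_neg h, mul_zero, mul_zero]

/-- Solution of `harmonic_recursion`. -/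
theorem harmonic_layer [CharZero K] {j : ℕ} {g : {s : Finset α // s.card = j} → K}
    (hg : g ∈ harmonic α K j) (A : Finset α) (t : ℕ) :
    (∑ T, if (T.1 \ A).card = t then g T else 0) =
      (-1) ^ t * (j.choose t : K) * ∑ T, if T.1 ⊆ A then g T else 0 := by
  induction t with
  | zero => simp [Finset.sdiff_eq_empty_iff_subset]
  | succ t ih =>
    have h := harmonic_recursion hg A t
    rw [ih] at h
    have ht : (t : K) + 1 ≠ 0 := by exact_mod_cast Nat.succ_ne_zero t
    have hch : (j.choose (t + 1) : K) * (t + 1) = j.choose t * (j - t) := by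
      rcases le_or_gt t j with htj | htj
      · rw [← Nat.cast_sub htj]
        exact_mod_cast Nat.choose_succ_right_eq j t
      · rw [Nat.choose_eq_zero_of_lt htj, Nat.choose_eq_zero_of_lt (by omega)]
        simp
    apply mul_left_cancel₀ ht
    rw [eq_neg_of_add_eq_zero_left h]
    rw [pow_succ]
    linear_combination ((-1) ^ t * ∑ T, if T.1 ⊆ A then g T else 0) * hch

/-- Sums of a harmonic function weighted by the number of points outside `A` are multiples of its sum
over the `j`-subsets of `A`. -/
theorem harmonic_sum_weight [CharZero K] {j : ℕ} {g : {s : Finset α // s.card = j} → K}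
    (hg : g ∈ harmonic α K j) (A : Finset α) (c : ℕ → K) :
    ∑ T, c (T.1 \ A).card * g T =
      (∑ t ∈ Finset.range (j + 1), (-1) ^ t * (j.choose t : K) * c t) *
        ∑ T, if T.1 ⊆ A then g T else 0 := by
  have h : ∀ T : {s : Finset α // s.card = j}, c (T.1 \ A).card * g T =
      ∑ t ∈ Finset.range (j + 1), c t * if (T.1 \ A).card = t then g T else 0 := fun T => by
    rw [Finset.sum_eq_single (T.1 \ A).card]
    · simp
    · intro t _ ht
      rw [if_neg ht.symm, mul_zero]
    · intro ht
      have := Finset.card_le_card (Finset.sdiff_subset (s := T.1) (t := A))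
      rw [T.2] at this
      simp at ht
      omega
  simp only [h]
  rw [Finset.sum_comm, Finset.sum_mul]
  refine Finset.sum_congr rfl fun t _ => ?_
  rw [← Finset.mul_sum, harmonic_layer hg]
  ring

/-- Summing a function lifted from `j`-sets over a family of `r`-sets. -/
theorem sum_sliceUp {j r : ℕ} (g : {s : Finset α // s.card = j} → K)
    (P : {s : Finset α // s.card = r} → Prop) [DecidablePred P] :
    ∑ B, (if P B then sliceUp α K j r g B else 0) =
      ∑ T, ((Finset.univ.filter fun B => T.1 ⊆ B.1 ∧ P B).card : K) * g T := by
  have h : ∀ B, (if P B then sliceUp α K j r g B else 0) =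
      ∑ T, if T.1 ⊆ B.1 ∧ P B then g T else 0 := fun B => by
    by_cases hP : P B <;> simp [hP, sliceUp]
  simp only [h]
  rw [Finset.sum_comm]
  refine Finset.sum_congr rfl fun T _ => ?_
  rw [← Finset.sum_filter, Finset.sum_const, nsmul_eq_mul]

/-- The lift of a harmonic function is an eigenvector of every relation of the Johnson scheme. -/
theorem sum_sliceUp_of_mem_harmonic [CharZero K] {n j r : ℕ} (hcard : Fintype.card α = n)
    (hjr : j ≤ r) (hn : 2 * r < n)
    {g : {s : Finset α // s.card = j} → K} (hg : g ∈ harmonic α K j)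
    (A : {s : Finset α // s.card = r}) (i : ℕ) :
    ∑ B : {s : Finset α // s.card = r},
      (if (B.1 \ A.1).card = i then sliceUp α K j r g B else 0) =
      (kneserP n r i j : K) * sliceUp α K j r g A := by
  have hP : kneserP n r i j = ∑ t ∈ Finset.range (j + 1), (-1 : ℤ) ^ t * (j.choose t : ℤ) *
      (((r - j + t).choose i : ℤ) *
        if t ≤ i then ((n - r - j + (j - t)).choose (i - t) : ℤ) else 0) := by
    rw [sum_choose_eq_sum_choose, kneserP]
    refine Finset.sum_congr rfl fun t _ => ?_
    split_ifs <;> ring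
  rw [sum_sliceUp]
  have h : ∀ T : {s : Finset α // s.card = j},
      ((Finset.univ.filter fun B : {s : Finset α // s.card = r} =>
        T.1 ⊆ B.1 ∧ (B.1 \ A.1).card = i).card : K) =
      (fun t : ℕ => ((r - j + t).choose i : K) *
        if t ≤ i then ((n - r - j + (j - t)).choose (i - t) : K) else 0) (T.1 \ A.1).card := by
    intro T
    rw [card_filter_superset_sdiff A.2 T.2 hjr (by omega) i, hcard]
    push_cast
    rfl
  simp only [h]
  rw [harmonic_sum_weight hg A.1 (fun t : ℕ => ((r - j + t).choose i : K) *
        if t ≤ i then ((n - r - j + (j - t)).choose (i - t) : K) else 0), hP]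
  push_cast
  rfl

/-- Summing the lift of a harmonic `g` over the `r`-sets containing `T₀` returns a non-zero multiple
of `g T₀`. -/
theorem sliceUp_injOn_harmonic [CharZero K] {j r : ℕ} (hjr : j ≤ r)
    (hn : 2 * r < Fintype.card α) {g : {s : Finset α // s.card = j} → K}
    (hg : g ∈ harmonic α K j) (h0 : sliceUp α K j r g = 0) : g = 0 := by
  ext T₀
  have h := sum_sliceUp (r := r) g (fun B => T₀.1 ⊆ B.1)
  have hc : ∀ T : {s : Finset α // s.card = j},
      ((Finset.univ.filter fun B : {s : Finset α // s.card = r} =>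
        T.1 ⊆ B.1 ∧ T₀.1 ⊆ B.1).card : K) =
      (fun t : ℕ => if t ≤ r - j then
        ((Fintype.card α - 2 * j + (j - t)).choose (r - j - t) : K) else 0)
          (T.1 \ T₀.1).card := by
    intro T
    have h1 : (T.1 ∪ T₀.1).card = (T.1 \ T₀.1).card + j := by
      rw [← Finset.card_sdiff_add_card, T₀.2]
    have h2 := Finset.card_le_card (Finset.sdiff_subset (s := T.1) (t := T₀.1))
    rw [T.2] at h2
    simp only [← Finset.union_subset_iff]
    rw [card_filter_superset, h1]
    by_cases h3 : (T.1 \ T₀.1).card ≤ r - j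
    · rw [if_pos h3, if_pos (by omega)]
      congr 2 <;> omega
    · rw [if_neg h3, if_neg (by omega), Nat.cast_zero]
  simp only [hc] at h
  rw [harmonic_sum_weight hg T₀.1 (fun t : ℕ => if t ≤ r - j then
        ((Fintype.card α - 2 * j + (j - t)).choose (r - j - t) : K) else 0)] at h
  have hsum : ∑ t ∈ Finset.range (j + 1), (-1) ^ t * (j.choose t : K) * (if t ≤ r - j then
        ((Fintype.card α - 2 * j + (j - t)).choose (r - j - t) : K) else 0) =
      ((Fintype.card α - 2 * j).choose (r - j) : K) := by
    -- the coefficient of `x ^ 0` leaves only the term `t = 0` on the right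
    have := congrArg (Int.cast : ℤ → K)
      (sum_choose_eq_sum_choose j 0 (Fintype.card α - 2 * j) 0 (r - j))
    push_cast at this
    rw [Finset.sum_eq_single (s := Finset.range (j + 1)) (f := fun t => _ * (ite (t ≤ 0) _ _ * _)) 0
      (by
        intro t _ ht
        rw [if_neg (by omega), zero_mul, mul_zero])
      (by simp)] at this
    simp only [Nat.choose_zero_right, Nat.cast_one, one_mul] at this
    rw [this]
    simp
  have hself : (∑ T : {s : Finset α // s.card = j}, if T.1 ⊆ T₀.1 then g T else 0) = g T₀ := by
    rw [Finset.sum_eq_single T₀ (by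
      intro T _ hT
      refine if_neg fun hs => hT (Subtype.ext (Finset.eq_of_subset_of_card_le hs ?_))
      rw [T.2, T₀.2]) (by simp)]
    simp
  rw [hsum, hself, h0] at h
  have hne : ((Fintype.card α - 2 * j).choose (r - j) : K) ≠ 0 := by
    rw [Nat.cast_ne_zero]
    exact (Nat.choose_pos (by omega)).ne'
  simpa [hne] using h.symm

end Slices

/-! ### Diagonalization along a direct sum decomposition -/

section Diagonalization

variable {K V ι : Type*} [Field K] [Fintype V] [DecidableEq V] [Fintype ι] [DecidableEq ι]

/-- A matrix acting as the scalar `c i` on each summand `E i` of a direct sum decomposition is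
diagonal in a basis adapted to the decomposition. -/
theorem charpoly_and_finrank_eigenspace_of_isInternal [DecidableEq K] (D : Matrix V V K)
    (E : ι → Submodule K (V → K)) (hE : DirectSum.IsInternal E) (c : ι → K)
    (hD : ∀ i, ∀ v ∈ E i, Matrix.toLin' D v = c i • v) :
    D.charpoly = ∏ i, (Polynomial.X - Polynomial.C (c i)) ^ Module.finrank K (E i) ∧
      ∀ μ, Module.finrank K (Module.End.eigenspace (Matrix.toLin' D) μ) =
        ∑ i, if c i = μ then Module.finrank K (E i) else 0 := by
  let b := hE.collectedBasis fun i => Module.finBasis K (E i)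
  let d : (Σ i, Fin (Module.finrank K (E i))) → K := fun x => c x.1
  have hdiag : Matrix.toLin' D = Matrix.toLin b b (Matrix.diagonal d) := by
    refine b.ext fun x => ?_
    rw [hD x.1 _ (hE.collectedBasis_mem _ x), Matrix.toLin_self]
    simp [Matrix.diagonal_apply, d, b]
  refine ⟨?_, fun μ => ?_⟩
  · rw [← Matrix.charpoly_toLin', hdiag, Matrix.charpoly_toLin, Matrix.charpoly_diagonal,
      Fintype.prod_sigma]
    simp [d]
  · have hsub : Matrix.toLin' D - μ • (1 : Module.End K (V → K)) =
        Matrix.toLin b b (Matrix.diagonal fun x => d x - μ) := by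
      refine b.ext fun x => ?_
      rw [hdiag, LinearMap.sub_apply, Matrix.toLin_self, Matrix.toLin_self]
      simp [Matrix.diagonal_apply, sub_smul]
    have h1 := LinearMap.finrank_range_add_finrank_ker
      (Matrix.toLin' D - μ • (1 : Module.End K (V → K)))
    rw [← Module.End.eigenspace_def, hsub, ← Matrix.rank_eq_finrank_range_toLin,
      Matrix.rank_diagonal, Module.finrank_eq_card_basis b] at h1
    have h2 := Fintype.card_subtype_compl (fun x => d x - μ = 0)
    have h3 := Fintype.card_subtype_le (fun x => d x - μ = 0)
    have h4 : Fintype.card {x // d x - μ = 0} =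
        ∑ i, if c i = μ then Module.finrank K (E i) else 0 := by
      rw [Fintype.card_subtype, Finset.card_filter, Fintype.sum_sigma]
      refine Finset.sum_congr rfl fun i _ => ?_
      simp [d, sub_eq_zero]
    rw [← h4]
    simp only [ne_eq] at h1
    omega

/-- Independent subspaces with large enough dimensions decompose the space. -/
theorem isInternal_of_iSupIndep_of_le {W : Type*} [AddCommGroup W] [Module K W]
    [FiniteDimensional K W] (E : ι → Submodule K W) (hE : iSupIndep E) (m : ι → ℕ)
    (hm : ∀ i, m i ≤ Module.finrank K (E i)) (hsum : ∑ i, m i = Module.finrank K W) :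
    DirectSum.IsInternal E ∧ ∀ i, Module.finrank K (E i) = m i := by
  have hinj : Function.Injective (DirectSum.coeLinearMap E) := hE.dfinsupp_lsum_injective
  have hfin : Module.finrank K (DirectSum ι fun i => E i) = ∑ i, Module.finrank K (E i) :=
    Module.finrank_directSum K _
  have hle := LinearMap.finrank_le_finrank_of_injective hinj
  have hle' := Finset.sum_le_sum fun i (_ : i ∈ Finset.univ) => hm i
  have heq : ∑ i, m i = ∑ i, Module.finrank K (E i) := by omega
  refine ⟨⟨hinj, (LinearMap.injective_iff_surjective_of_finrank_eq_finrank (by omega)).1 hinj⟩,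
    fun i => ?_⟩
  exact ((Finset.sum_eq_sum_iff_of_le fun i _ => hm i).1 heq i (Finset.mem_univ i)).symm

end Diagonalization

/-! ### Multiplicities and separation of eigenvalues -/

/-- The dimension of the space of harmonic functions on `j`-sets for `2j < n`: the difference
`C(n, j) - C(n, j - 1)`, with `C(n, -1) = 0`. -/
def harmonicDim (n j : ℕ) : ℕ :=
  n.choose j - if j = 0 then 0 else n.choose (j - 1)

theorem choose_pred_le {n j : ℕ} (h : 2 * j < n) :
    (if j = 0 then 0 else n.choose (j - 1)) ≤ n.choose j := by
  rcases j with _ | j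
  · simp
  · simpa using Nat.choose_le_succ_of_lt_half_left (r := j) (n := n) (by omega)

theorem sum_harmonicDim {n r : ℕ} (h : 2 * r < n) :
    ∑ j ∈ Finset.range (r + 1), harmonicDim n j = n.choose r := by
  induction r with
  | zero => simp [harmonicDim]
  | succ r ih =>
    rw [Finset.sum_range_succ, ih (by omega), harmonicDim]
    have := choose_pred_le h
    simp at this ⊢
    omega

theorem cast_harmonicDim {n j : ℕ} (h : 2 * j < n) :
    (harmonicDim n j : ℚ) =
      ((n : ℚ) - 2 * (j : ℚ) + 1) / ((n : ℚ) - (j : ℚ) + 1) * (n.choose j : ℚ) := by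
  have hne : (n : ℚ) - j + 1 ≠ 0 := by
    have : (j : ℚ) ≤ n := by exact_mod_cast (by omega : j ≤ n)
    linarith
  rw [harmonicDim, Nat.cast_sub (choose_pred_le h), div_mul_eq_mul_div, eq_div_iff hne]
  rcases j with _ | j
  · simp
  · have h1 : ((n.choose (j + 1) : ℕ) : ℚ) * (j + 1) = n.choose j * (n - j) := by
      rw [← Nat.cast_sub (by omega)]
      exact_mod_cast Nat.choose_succ_right_eq n j
    simp only [Nat.add_one_ne_zero, if_false, Nat.add_sub_cancel]
    push_cast
    linear_combination h1

/-- The eigenvalues `p_1(j) = (r - j) * (n - r - j) - j` of the first relation separate the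
harmonic components. -/
theorem kneserP_one {n r j : ℕ} (hjr : j ≤ r) (hn : 2 * r < n) :
    kneserP n r 1 j = ((r : ℤ) - j) * ((n : ℤ) - r - j) - j := by
  have h1 : ((r - j : ℕ) : ℤ) = (r : ℤ) - j := by omega
  have h2 : ((n - r - j : ℕ) : ℤ) = (n : ℤ) - r - j := by omega
  rw [kneserP, ← h1, ← h2]
  rcases j with _ | j
  · simp
  · rw [Finset.sum_range_succ', Finset.sum_range_succ', Finset.sum_eq_zero]
    · simp
      ring
    · intro t _
      rw [if_neg (by omega)]

theorem kneserP_one_injective {n r j k : ℕ} (hj : j ≤ r) (hk : k ≤ r) (hn : 2 * r < n)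
    (h : kneserP n r 1 j = kneserP n r 1 k) : j = k := by
  rw [kneserP_one hj hn, kneserP_one hk hn] at h
  have h1 : ((j : ℤ) - k) * ((j : ℤ) + k - n - 1) = 0 := by linear_combination h
  rcases mul_eq_zero.1 h1 with h2 | h2 <;> omega

/-! ### The harmonic decomposition -/

section Spectrum

variable (n r : ℕ) (K : Type*) [Field K]

/-- The functions on `r`-sets lifted from harmonic functions on `j`-sets. -/
def harmonicLift (j : ℕ) : Submodule K ({s : Finset (Fin n) // s.card = r} → K) :=
  LinearMap.range ((sliceUp (Fin n) K j r).comp (harmonic (Fin n) K j).subtype)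

variable {n r K}

/-- Rank-nullity for the down operator. -/
theorem le_finrank_harmonic (j : ℕ) :
    harmonicDim n j ≤ Module.finrank K (harmonic (Fin n) K j) := by
  have h := LinearMap.finrank_range_add_finrank_ker (sliceDown (Fin n) K j)
  have h1 := (LinearMap.range (sliceDown (Fin n) K j)).finrank_le
  rw [Module.finrank_fintype_fun_eq_card, Fintype.card_finset_len, Fintype.card_fin] at h
  have h2 : Module.finrank K ({s : Finset (Fin n) // s.card + 1 = j} → K) =
      if j = 0 then 0 else n.choose (j - 1) := by
    rw [Module.finrank_fintype_fun_eq_card]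
    rcases j with _ | j
    · simp
    · simp [Fintype.card_finset_len]
  rw [h2] at h1
  rw [harmonicDim, harmonic]
  omega

theorem le_finrank_harmonicLift [CharZero K] {j : ℕ} (hjr : j ≤ r) (hn : 2 * r < n) :
    harmonicDim n j ≤ Module.finrank K (harmonicLift n r K j) := by
  rw [harmonicLift, LinearMap.finrank_range_of_inj]
  · exact le_finrank_harmonic j
  · refine (injective_iff_map_eq_zero _).2 fun g hg => Subtype.ext ?_
    exact sliceUp_injOn_harmonic hjr (by simpa using hn) g.2 hg

/-- A matrix whose entries depend only on `|B \ A|` acts on the lifts of harmonic functions of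
degree `j` as a scalar. -/
theorem toLin'_harmonicLift [CharZero K] {j : ℕ} (hjr : j ≤ r) (hn : 2 * r < n) (c : ℕ → K)
    {v : {s : Finset (Fin n) // s.card = r} → K} (hv : v ∈ harmonicLift n r K j) :
    Matrix.toLin' (Matrix.of fun A B : {s : Finset (Fin n) // s.card = r} =>
      c (B.1 \ A.1).card) v = (∑ i ∈ Finset.range (r + 1), c i * (kneserP n r i j : K)) • v := by
  obtain ⟨g, rfl⟩ := hv
  ext A
  simp only [Matrix.toLin'_apply, Matrix.mulVec, dotProduct, Matrix.of_apply, Pi.smul_apply,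
    smul_eq_mul, LinearMap.comp_apply, Submodule.subtype_apply, Finset.sum_mul, mul_assoc]
  simp only [← sum_sliceUp_of_mem_harmonic (Fintype.card_fin n) hjr hn g.2 A, Finset.mul_sum]
  rw [Finset.sum_comm]
  refine Finset.sum_congr rfl fun B _ => ?_
  rw [Finset.sum_eq_single (B.1 \ A.1).card]
  · simp
  · intro i _ hi
    rw [if_neg hi.symm, mul_zero]
  · intro hi
    have := Finset.card_le_card (Finset.sdiff_subset (s := B.1) (t := A.1))
    rw [B.2] at this
    simp at hi
    omega

/-- The lifts of harmonic functions of degrees `0, …, r` decompose the space of functions on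
`r`-sets. -/
theorem isInternal_harmonicLift [CharZero K] (hn : 2 * r < n) :
    DirectSum.IsInternal (fun j : Fin (r + 1) => harmonicLift n r K j) ∧
      ∀ j : Fin (r + 1), Module.finrank K (harmonicLift n r K j) = harmonicDim n j := by
  refine isInternal_of_iSupIndep_of_le _ ?_ _
    (fun j => le_finrank_harmonicLift (by omega) hn) ?_
  · let A₁ : Matrix {s : Finset (Fin n) // s.card = r} {s : Finset (Fin n) // s.card = r} K :=
      Matrix.of fun A B => if (B.1 \ A.1).card = 1 then 1 else 0
    have hinj : Function.Injective fun j : Fin (r + 1) =>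
        ∑ i ∈ Finset.range (r + 1), (if i = 1 then (1 : K) else 0) * (kneserP n r i j : K) := by
      intro j k h
      rcases Nat.eq_zero_or_pos r with hr | hr
      · exact Fin.ext (by omega)
      have h1 : 1 ∈ Finset.range (r + 1) := by simp; omega
      simp only [ite_mul, one_mul, zero_mul, Finset.sum_ite_eq', if_pos h1] at h
      exact Fin.ext (kneserP_one_injective (by omega) (by omega) hn (Int.cast_injective h))
    refine ((Module.End.eigenspaces_iSupIndep (Matrix.toLin' A₁)).comp hinj).mono fun j v hv => ?_
    rw [Function.comp_apply, Module.End.mem_eigenspace_iff]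
    exact toLin'_harmonicLift (by omega) hn (fun i => if i = 1 then 1 else 0) hv
  · rw [Module.finrank_fintype_fun_eq_card, Fintype.card_finset_len, Fintype.card_fin,
      ← sum_harmonicDim hn, Finset.sum_range]

theorem expDistMatrix_kneserGraph (hn : 2 * r < n) (q : K) :
    (kneserGraph n r).expDistMatrix q =
      Matrix.of fun A B : {s : Finset (Fin n) // s.card = r} =>
        q ^ kneserF n r (B.1 \ A.1).card := by
  ext A B
  obtain ⟨h1, h2⟩ := kneserGraph_reachable_and_dist hn A B
  simp only [SimpleGraph.expDistMatrix, Matrix.of_apply, if_pos h1, h2]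

end Spectrum

end KneserSpectrum

open KneserSpectrum

theorem mainTheorem11 {K : Type*} [Field K] [CharZero K] [DecidableEq K] (q : K)
    (n r : ℕ) (hnr : 2 * r < n) :
    ∃ m : ℕ → ℕ,
      (∀ j ≤ r, (m j : ℚ) =
        ((n : ℚ) - 2 * (j : ℚ) + 1) / ((n : ℚ) - (j : ℚ) + 1) * (n.choose j : ℚ)) ∧
      ((kneserGraph n r).expDistMatrix q).charpoly =
        ∏ j ∈ Finset.range (r + 1),
          (Polynomial.X - Polynomial.C (kneserEigenvalue q n r j)) ^ m j ∧
      ∀ μ : K,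
        Module.finrank K
            (Module.End.eigenspace (Matrix.toLin' ((kneserGraph n r).expDistMatrix q)) μ) =
          ∑ j ∈ Finset.range (r + 1), if kneserEigenvalue q n r j = μ then m j else 0 := by
  obtain ⟨hint, hdim⟩ := isInternal_harmonicLift (K := K) hnr
  obtain ⟨h1, h2⟩ := charpoly_and_finrank_eigenspace_of_isInternal
    ((kneserGraph n r).expDistMatrix q) _ hint (fun j => kneserEigenvalue q n r j) (by
      intro j v hv
      rw [expDistMatrix_kneserGraph hnr]
      exact toLin'_harmonicLift (by omega) hnr (fun i => q ^ kneserF n r i) hv)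
  refine ⟨harmonicDim n, fun j hj => cast_harmonicDim (by omega), ?_, fun μ => ?_⟩
  · rw [h1, Finset.prod_range]
    simp only [hdim]
  · rw [h2, Finset.sum_range]
    simp only [hdim]
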